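/- Let $a,N$ be integers with $1\le a\le N$. For positive integers $s_1,\ldots,s_u$ put $$t^{\star}_{N,a}(s_1,\ldots,s_u)=\sum_{k_1\ge\cdots\ge k_u\ge0}\frac{1}{(Nk_1+a)^{s_1}\cdots(Nk_u+a)^{s_u}},$$ and for nonzero integers $s_1,\ldots,s_u$, $u\ge1$, put $$\widetilde t_{N,a}(s_1,\ldots,s_u)=\sum_{k_1>\cdots>k_u\ge0}\frac{\operatorname{sign}(s_1)^{k_1}\cdots\operatorname{sign}(s_u)^{k_u}}{(Nk_1+a)^{|s_1|}\cdots(Nk_u+a)^{|s_u|}}\cdot\frac{\left(\frac{2a}{N}\right)_{k_u}}{k_u!},$$ where $(x)_0=1$ and $(x)_m=x(x+1)\cdots(x+m-1)$ for $m\ge1$, whenever these series converge. For real $r$ put $$\widetilde t^{\,r}_{N,a}(s_1,\ldots,s_u)=\sum_{\circ}r^{\#\text{pluses}}\;\widetilde t_{N,a}(s_1\circ s_2\circ\cdots\circ s_u),$$ the sum running over all $2^{u-1}$ ways of replacing each symbol $\circ$ by a comma or by a plus, where $s+l$ denotes $|s|+|l|$ if $sl>0$ and $-(|s|+|l|)$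 if $sl<0$. A bar over a positive integer $s$ means that the corresponding argument is $-s$, and $\{2\}^b$ denotes $2$ repeated $b$ times (the empty string if $b=0$). Let $B(x,y)=\Gamma(x)\Gamma(y)/\Gamma(x+y)$ be the Beta function. Then for all integers $d\ge1$, $b_0\ge1$ and $b_1,\ldots,b_d\ge0$, the series $t^{\star}_{N,a}(\{2\}^{b_0},1,\{2\}^{b_1},\ldots,1,\{2\}^{b_d})$ and all the series $\widetilde t_{N,a}(\cdot)$ occurring in $\widetilde t^{\,1/2}_{N,a}(2b_0+1,2b_1+1,\ldots,2b_{d-1}+1,\overline{2b_d+1})$ converge absolutely, and $$t^{\star}_{N,a}(\{2\}^{b_0},1,\{2\}^{b_1},\ldots,1,\{2\}^{b_d})=\frac{2^{d+1}N}{B\left(\frac aN,\frac aN\right)}\;\widetilde t^{\,1/2}_{N,a}(2b_0+1,2b_1+1,\ldots,2b_{d-1}+1,\overline{2b_d+1}).$$ -/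

import Mathlib

/-- The term `∏ i, 1 / (N k_i + a) ^ s_i` of the series `t⋆_{N,a}(s_1, …, s_u)`. -/
noncomputable def tStarTerm (N a : ℕ) (s : List ℕ) (k : Fin s.length → ℕ) : ℝ :=
  ∏ i : Fin s.length, 1 / ((N : ℝ) * k i + a) ^ s.get i

/-- The multiple t-star value of level `N`: the sum over all `k_1 ≥ ⋯ ≥ k_u ≥ 0`. -/
noncomputable def tStar (N a : ℕ) (s : List ℕ) : ℝ :=
  ∑' k : {k : Fin s.length → ℕ // Antitone k}, tStarTerm N a s k

/-- The factor `(2a/N)_m / m!`, with the Pochhammer symbol `(x)_m = x (x+1) ⋯ (x+m-1)`. -/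
noncomputable def pochWeight (N a m : ℕ) : ℝ :=
  (ascPochhammer ℝ m).eval (2 * (a : ℝ) / N) / (m.factorial : ℝ)

/-- The term of the series `t̃_{N,a}(s_1, …, s_u)`; a negative entry `-n` encodes the barred
entry `n`, and the factor `(2a/N)_{k_u} / k_u!` occurs for the last index only. -/
noncomputable def tTildeTerm (N a : ℕ) (s : List ℤ) (k : Fin s.length → ℕ) : ℝ :=
  ∏ i : Fin s.length,
    (((s.get i).sign : ℝ) ^ k i / ((N : ℝ) * k i + a) ^ (s.get i).natAbs *
      if (i : ℕ) + 1 = s.length then pochWeight N a (k i) else 1)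

/-- The alternating multiple t-value of level `N` with factorial and Pochhammer symbols:
the sum over all `k_1 > ⋯ > k_u ≥ 0`. -/
noncomputable def tTilde (N a : ℕ) (s : List ℤ) : ℝ :=
  ∑' k : {k : Fin s.length → ℕ // StrictAnti k}, tTildeTerm N a s k

/-- The addition of signed indices: absolute values add, signs multiply. -/
def signedAdd (s l : ℤ) : ℤ :=
  if 0 < s * l then |s| + |l| else -(|s| + |l|)

/-- `s ∘ l_1 ∘ ⋯ ∘ l_u`, where each `∘` is a plus (`true`) or a comma (`false`) and the
symbol in front of an entry is stored together with that entry. -/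
def fillSymbols : ℤ → List (Bool × ℤ) → List ℤ
  | s, [] => [s]
  | s, (true, l) :: r => fillSymbols (signedAdd s l) r
  | s, (false, l) :: r => s :: fillSymbols l r

/-- The index string `s_0 ∘ s_1 ∘ ⋯ ∘ s_d` for the choice of symbols `ε`. -/
def joinIndex {d : ℕ} (s : Fin (d + 1) → ℤ) (ε : Fin d → Bool) : List ℤ :=
  fillSymbols (s 0) (List.ofFn fun i : Fin d => (ε i, s i.succ))

/-- The interpolated value `t̃^r_{N,a}(s_0, …, s_d)`: the sum over all choices of symbols of
`r ^ #pluses * t̃_{N,a}(s_0 ∘ ⋯ ∘ s_d)`. -/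
noncomputable def tTildeInterp (N a : ℕ) (r : ℝ) {d : ℕ} (s : Fin (d + 1) → ℤ) : ℝ :=
  ∑ ε : Fin d → Bool,
    r ^ (Finset.univ.filter fun i => ε i = true).card * tTilde N a (joinIndex s ε)

/-- The string `{2}^{b_0}, 1, {2}^{b_1}, …, 1, {2}^{b_d}`. -/
def twosOnes {d : ℕ} (b : Fin (d + 1) → ℕ) : List ℕ :=
  List.replicate (b 0) 2 ++
    (List.ofFn fun i : Fin d => 1 :: List.replicate (b i.succ) 2).flatten

/-- The signed indices `2b_0+1, …, 2b_{d-1}+1`, and `2b_d+1` with a bar. -/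
def oddIndices {d : ℕ} (b : Fin (d + 1) → ℕ) (i : Fin (d + 1)) : ℤ :=
  if i = Fin.last d then -(2 * (b i : ℤ) + 1) else 2 * (b i : ℤ) + 1

/-!
Put `α = a/N` and `D(k) = Nk + a`. The proof compares finite truncations of both sides by means
of the kernel

  `K(n,k) = Γ(n+α+1)² / ((n-k)! Γ(n+k+2α+1))`  (`connector`)

and the transform `T g (n) = ∑_{k ≤ n} K(n,k) g(k)` (`transform`). The kernel satisfies
`K(n-1,k) = (1 - D(k)²/D(n)²) K(n,k)`, and from this follow three rules.

* Summing `T g (m) / D(m)²` over `m ≤ n` gives `T (g / D²)` (`sum_transform_div_sq`), because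
  the two sides have the same differences in `n`.
* Summing `T g (m) / D(m)` over `m ≤ n` gives the transform of
  `k ↦ (2 ∑_{j < k} g(j) + g(k)) / D(k)` (`sum_transform_div`). This is where the interpolation
  parameter `1/2` comes from: an equality `j = k` counts half as much as an inequality `j < k`.
* The constant `1` is the transform of `2N / B(α,α) · (-1)^k (2α)_k / (k! D(k))`
  (`transform_pochWeight`), because a well-poised sum telescopes to zero.

The truncation of `t⋆({2}^{b_0}, 1, …, 1, {2}^{b_d})` at `n` is built from the constant `1` by
summations against `1/D²` and `1/D`. By the three rules it is the transform of an explicit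
sequence `h` (`starSum_twosOnes`), and the sum of `h` is the interpolated value on the right
(`sum_joinIndex_listSum`).

As `n → ∞`, `K(n,k)` tends to `1` and is dominated by the bounded sequence `K(n,0)`, so the
identity follows from the summability of `h` by dominated convergence (`transform_tendsto`).
Since `(2α)_k / k! ≤ k + 1 ≤ D(k)`, induction shows that, up to a constant factor, `|h(k)|` is
at most `1 / (k+1)^{2b_0}` (`abs_nested_le`). As `b_0 ≥ 1`, this yields the summability of `h`.
The same bound for absolute values gives the absolute convergence of all the series `t̃`, and that
of `t⋆` follows from the boundedness of its truncations.
-/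

open Filter Topology Finset

/-! ### Sums over decreasing chains of indices -/

theorem cons_eq_cons_iff {u : ℕ} {m m' : ℕ} {k k' : Fin u → ℕ} :
    (Fin.cons m k : Fin (u + 1) → ℕ) = Fin.cons m' k' ↔ m = m' ∧ k = k' :=
  Fin.cons_inj

/-- Prepending the entry `m` to a tuple, as an embedding. -/
def consEmbedding {u : ℕ} (m : ℕ) : (Fin u → ℕ) ↪ (Fin (u + 1) → ℕ) :=
  ⟨fun k => Fin.cons m k, fun _ _ h => (cons_eq_cons_iff.1 h).2⟩

theorem consEmbedding_apply {u : ℕ} (m : ℕ) (k : Fin u → ℕ) :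
    consEmbedding m k = (Fin.cons m k : Fin (u + 1) → ℕ) := rfl

/-- The chains `n ≥ k_1 + c`, `k_i ≥ k_{i+1} + c`. The gap `c` is `0` for weakly and `1` for
strictly decreasing chains. -/
def chainSet (c : ℕ) : (u : ℕ) → ℕ → Finset (Fin u → ℕ)
  | 0, _ => Finset.univ
  | u + 1, n => (range (n + 1 - c)).biUnion fun m =>
      (chainSet c u m).map (consEmbedding m)

theorem mem_chainSet (c u n : ℕ) (k : Fin u → ℕ) :
    k ∈ chainSet c u n ↔ (∀ i, k i + c ≤ n) ∧ ∀ i j, i < j → k j + c ≤ k i := by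
  induction u generalizing n with
  | zero => simp [chainSet, eq_iff_true_of_subsingleton]
  | succ u ih =>
    induction k using Fin.consCases with
    | _ m k =>
    simp only [chainSet, mem_biUnion, mem_range, Finset.mem_map, consEmbedding_apply,
      cons_eq_cons_iff, ih]
    constructor
    · rintro ⟨m', hm', k', ⟨h1, h2⟩, rfl, rfl⟩
      refine ⟨fun i => ?_, fun i j hij => ?_⟩
      · cases i using Fin.cases with
        | zero => simp only [Fin.cons_zero]; omega
        | succ i => have := h1 i; simp only [Fin.cons_succ]; omega
      · cases j using Fin.cases with
        | zero => exact absurd hij (Fin.not_lt_zero i)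
        | succ j =>
          cases i using Fin.cases with
          | zero => simpa using h1 j
          | succ i => simpa using h2 i j (by simpa using hij)
    · rintro ⟨h1, h2⟩
      refine ⟨m, ?_, k, ⟨fun i => ?_, fun i j hij => ?_⟩, rfl, rfl⟩
      · have := h1 0
        simp only [Fin.cons_zero] at this
        omega
      · simpa using h2 0 i.succ (Fin.succ_pos i)
      · simpa using h2 i.succ j.succ (by simpa using hij)

/-- The sum of `∏ i, w_i (k_i)` over the chains in `chainSet c u n`. -/
noncomputable def chainSum (c : ℕ) {u : ℕ} (w : Fin u → ℕ → ℝ) (n : ℕ) : ℝ :=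
  ∑ k ∈ chainSet c u n, ∏ i, w i (k i)

theorem chainSum_zero (c : ℕ) (w : Fin 0 → ℕ → ℝ) (n : ℕ) : chainSum c w n = 1 := by
  simp [chainSum, chainSet]

theorem chainSum_succ (c : ℕ) {u : ℕ} (w : Fin (u + 1) → ℕ → ℝ) (n : ℕ) :
    chainSum c w n = ∑ m ∈ range (n + 1 - c), w 0 m * chainSum c (fun i => w i.succ) m := by
  unfold chainSum
  rw [chainSet, sum_biUnion]
  · refine sum_congr rfl fun m _ => ?_
    rw [sum_map, mul_sum]
    refine sum_congr rfl fun k _ => ?_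
    simp [Fin.prod_univ_succ, consEmbedding_apply]
  · intro m _ m' _ hmm
    rw [Function.onFun, disjoint_left]
    intro k hk hk'
    simp only [Finset.mem_map, consEmbedding_apply] at hk hk'
    obtain ⟨k1, -, rfl⟩ := hk
    obtain ⟨k2, -, h⟩ := hk'
    exact hmm (cons_eq_cons_iff.1 h).1.symm

/-- A chain series whose truncated sums of absolute values are bounded converges absolutely,
and its truncations tend to its sum. -/
theorem summable_and_tendsto_chainSum (c : ℕ) {u : ℕ} (w : Fin u → ℕ → ℝ)
    {p : (Fin u → ℕ) → Prop} (hp : ∀ k, p k ↔ ∀ i j, i < j → k j + c ≤ k i) {C : ℝ}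
    (hC : ∀ n, chainSum c (fun i m => |w i m|) n ≤ C) :
    Summable (fun k : {k // p k} => ∏ i, w i (k.1 i)) ∧
    Tendsto (chainSum c w) atTop (𝓝 (∑' k : {k // p k}, ∏ i, w i (k.1 i))) := by
  classical
  let A : ℕ → Finset {k // p k} := fun n => (chainSet c u n).subtype p
  have hA : ∀ (v : Fin u → ℕ → ℝ) n, ∑ k ∈ A n, ∏ i, v i (k.1 i) = chainSum c v n := by
    intro v n
    refine sum_subtype_of_mem (fun k : Fin u → ℕ => ∏ i, v i (k i)) fun k hk => ?_
    exact (hp k).2 ((mem_chainSet ..).1 hk).2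
  have hmono : Monotone A := by
    intro n n' hn k hk
    simp only [A, mem_subtype, mem_chainSet] at hk ⊢
    exact ⟨fun i => (hk.1 i).trans hn, hk.2⟩
  have hex : ∀ k : {k // p k}, ∃ n, k ∈ A n := by
    intro k
    refine ⟨∑ i, k.1 i + c, ?_⟩
    simp only [A, mem_subtype, mem_chainSet]
    refine ⟨fun i => ?_, (hp _).1 k.2⟩
    gcongr
    exact single_le_sum (f := k.1) (fun _ _ => Nat.zero_le _) (mem_univ i)
  have htop : Tendsto A atTop atTop := tendsto_atTop_finset_of_monotone hmono hex
  have hs : Summable (fun k : {k // p k} => ∏ i, w i (k.1 i)) := by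
    refine Summable.of_abs (summable_of_sum_le (c := C) (fun _ => abs_nonneg _) fun s => ?_)
    obtain ⟨n, hn⟩ := (htop.eventually_ge_atTop s).exists
    refine (sum_le_sum_of_subset_of_nonneg hn fun _ _ _ => abs_nonneg _).trans ?_
    simp only [abs_prod]
    exact (hA (fun i m => |w i m|) n).trans_le (hC n)
  refine ⟨hs, ?_⟩
  have := hs.hasSum.comp htop
  simpa only [Function.comp_def, hA] using this

/-! ### The connecting kernel -/

/-- The kernel `Γ(n+α+1)² / ((n-k)! Γ(n+k+2α+1))`, written without Gamma factors in `n` so that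
it vanishes for `k > n` without a case distinction. -/
noncomputable def connector (α : ℝ) (n k : ℕ) : ℝ :=
  ProbabilityTheory.beta α α *
    ((∏ j ∈ range (n + 1), (α + j)) ^ 2 / (n.factorial * ∏ j ∈ range (n + 1), (2 * α + j))) *
    ∏ j ∈ range k, ((n : ℝ) - j) / (n + j + 1 + 2 * α)

theorem connector_eq_zero (α : ℝ) {n k : ℕ} (h : n < k) : connector α n k = 0 := by
  unfold connector
  rw [prod_eq_zero (mem_range.2 h) (by simp), mul_zero]

theorem connector_succ_right {α : ℝ} (hα : 0 < α) (n k : ℕ) :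
    (n + k + 1 + 2 * α) * connector α n (k + 1) = (n - k) * connector α n k := by
  unfold connector
  rw [prod_range_succ _ k]
  have : (n : ℝ) + k + 1 + 2 * α ≠ 0 := by positivity
  field_simp

/-- Passing from `n` to `n + 1` multiplies the kernel by the reciprocal of
`1 - (k+α)² / (n+1+α)²`. -/
theorem connector_succ_left {α : ℝ} (hα : 0 < α) (n k : ℕ) :
    (n + 1 - k) * (n + 1 + k + 2 * α) * connector α (n + 1) k =
      (n + 1 + α) ^ 2 * connector α n k := by
  induction k with
  | zero =>
    unfold connector
    rw [prod_range_succ _ (n + 1), prod_range_succ _ (n + 1), Nat.factorial_succ]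
    have h1 : ∏ j ∈ range (n + 1), (2 * α + j) ≠ 0 := prod_ne_zero_iff.2 fun j _ => by positivity
    have h2 : (n.factorial : ℝ) ≠ 0 := by positivity
    have h3 : 2 * α + ((n + 1 : ℕ) : ℝ) ≠ 0 := by positivity
    have h4 : ((n + 1 : ℕ) : ℝ) ≠ 0 := by positivity
    push_cast at h3 h4 ⊢
    simp only [range_zero, prod_empty, mul_one]
    field_simp
    ring
  | succ k ih =>
    have h1 := connector_succ_right hα (n + 1) k
    have h2 := connector_succ_right hα n k
    have h3 : (n : ℝ) + k + 1 + 2 * α ≠ 0 := by positivity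
    push_cast at h1 ⊢
    refine mul_left_cancel₀ h3 ?_
    linear_combination (n - k : ℝ) * (n + k + 1 + 2 * α) * h1 + (n - k : ℝ) * ih -
      (n + 1 + α) ^ 2 * h2

/-- Up to the Beta factor, `connector α n 0` is `GammaSeq (2α) n / GammaSeq α n ^ 2`. -/
theorem connector_zero_right_tendsto {α : ℝ} (hα : 0 < α) :
    Tendsto (fun n => connector α n 0) atTop (𝓝 1) := by
  have h2 : (0 : ℝ) < 2 * α := by positivity
  have hlim := ((Real.GammaSeq_tendsto_Gamma (2 * α)).div
    ((Real.GammaSeq_tendsto_Gamma α).pow 2)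
    (pow_ne_zero 2 (Real.Gamma_pos_of_pos hα).ne')).const_mul (ProbabilityTheory.beta α α)
  have hval : ProbabilityTheory.beta α α * (Real.Gamma (2 * α) / Real.Gamma α ^ 2) = 1 := by
    have := (Real.Gamma_pos_of_pos hα).ne'
    have := (Real.Gamma_pos_of_pos h2).ne'
    rw [ProbabilityTheory.beta, ← two_mul]
    field_simp
  rw [hval] at hlim
  refine hlim.congr' ?_
  filter_upwards [eventually_gt_atTop 0] with n hn
  have hn' : (0 : ℝ) < n := by exact_mod_cast hn
  have e : (n : ℝ) ^ (2 * α) = ((n : ℝ) ^ α) ^ 2 := by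
    rw [mul_comm, Real.rpow_mul hn'.le, Real.rpow_two]
  have h3 : ∏ j ∈ range (n + 1), (2 * α + j) ≠ 0 := prod_ne_zero_iff.2 fun j _ => by positivity
  have h4 : ∏ j ∈ range (n + 1), (α + j) ≠ 0 := prod_ne_zero_iff.2 fun j _ => by positivity
  have h5 : (n : ℝ) ^ α ≠ 0 := (Real.rpow_pos_of_pos hn' α).ne'
  have h6 : (n.factorial : ℝ) ≠ 0 := by positivity
  simp only [Real.GammaSeq, connector, Pi.div_apply, e, range_zero, prod_empty,
    mul_one]
  field_simp

theorem connector_tendsto {α : ℝ} (hα : 0 < α) (k : ℕ) :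
    Tendsto (fun n => connector α n k) atTop (𝓝 1) := by
  induction k with
  | zero => exact connector_zero_right_tendsto hα
  | succ k ih =>
    have hr : Tendsto (fun n : ℕ => ((n : ℝ) - k) / (n + k + 1 + 2 * α)) atTop (𝓝 1) := by
      have := tendsto_add_mul_div_add_mul_atTop_nhds (-(k : ℝ)) (k + 1 + 2 * α) 1 one_ne_zero
        (𝕜 := ℝ)
      simp only [one_mul, div_one] at this
      exact this.congr fun n => by congr 1 <;> ring
    have := hr.mul ih
    rw [one_mul] at this
    refine this.congr fun n => ?_
    have h := connector_succ_right hα n k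
    have h3 : (n : ℝ) + k + 1 + 2 * α ≠ 0 := by positivity
    field_simp
    linarith

theorem connector_nonneg_and_le {α : ℝ} (hα : 0 < α) (n k : ℕ) :
    0 ≤ connector α n k ∧ connector α n k ≤ connector α n 0 := by
  have h0 : 0 ≤ connector α n 0 := by
    have := ProbabilityTheory.beta_pos hα hα
    unfold connector
    simp only [range_zero, prod_empty, mul_one]
    have h1 : 0 ≤ ∏ j ∈ range (n + 1), (2 * α + j) := prod_nonneg fun j _ => by positivity
    positivity
  induction k with
  | zero => exact ⟨h0, le_rfl⟩
  | succ k ih =>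
    rcases Nat.lt_or_ge n (k + 1) with h | h
    · rw [connector_eq_zero α h]
      exact ⟨le_rfl, h0⟩
    · have hk : (k : ℝ) + 1 ≤ n := by exact_mod_cast h
      have h3 : 0 < (n : ℝ) + k + 1 + 2 * α := by positivity
      have e : connector α n (k + 1) = ((n : ℝ) - k) / (n + k + 1 + 2 * α) * connector α n k := by
        have h := connector_succ_right hα n k
        field_simp
        linarith
      have r0 : 0 ≤ ((n : ℝ) - k) / (n + k + 1 + 2 * α) := div_nonneg (by linarith) h3.le
      have r1 : ((n : ℝ) - k) / (n + k + 1 + 2 * α) ≤ 1 := by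
        rw [div_le_one h3]
        have : (0 : ℝ) ≤ k := k.cast_nonneg
        linarith
      rw [e]
      exact ⟨mul_nonneg r0 ih.1, (mul_le_of_le_one_left ih.1 r1).trans ih.2⟩

/-! ### The connecting transform -/

/-- The transform `g ↦ ∑_{k ≤ n} connector α n k * g k`. It intertwines the summations that
build `t⋆` with those that build `t̃`. -/
noncomputable def transform (α : ℝ) (g : ℕ → ℝ) (n : ℕ) : ℝ :=
  ∑ k ∈ range (n + 1), connector α n k * g k

theorem transform_const_mul (α c : ℝ) (g : ℕ → ℝ) (n : ℕ) :
    transform α (fun k => c * g k) n = c * transform α g n := by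
  simp only [transform, mul_sum]
  exact sum_congr rfl fun k _ => by ring

/-- The kernel is dominated by the bounded sequence `connector α n 0` and tends to `1`, so the
transform of a summable sequence tends to its sum. -/
theorem transform_tendsto {α : ℝ} (hα : 0 < α) {g : ℕ → ℝ} (hg : Summable g) :
    Tendsto (transform α g) atTop (𝓝 (∑' k, g k)) := by
  obtain ⟨C, hC⟩ := (connector_zero_right_tendsto hα).bddAbove_range
  have hC' : ∀ n, connector α n 0 ≤ C := fun n => hC ⟨n, rfl⟩
  have h := tendsto_tsum_of_dominated_convergence (𝓕 := atTop)
    (f := fun n k => connector α n k * g k) (g := g) (bound := fun k => C * |g k|)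
    (hg.abs.mul_left C) (fun k => by simpa using (connector_tendsto hα k).mul_const (g k))
    (Eventually.of_forall fun n k => by
      obtain ⟨h0, h1⟩ := connector_nonneg_and_le hα n k
      rw [Real.norm_eq_abs, abs_mul, abs_of_nonneg h0]
      gcongr
      exact h1.trans (hC' n))
  refine h.congr fun n => ?_
  refine tsum_eq_sum fun k hk => ?_
  rw [connector_eq_zero α (by simpa using hk), zero_mul]

section

variable {N a : ℕ}

theorem denom_pos (ha : 1 ≤ a) (k : ℕ) : (0 : ℝ) < N * k + a := by
  have : (1 : ℝ) ≤ a := by exact_mod_cast ha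
  positivity

/-- The first difference in `n` of the transform multiplies `g` by `(Nk+a)² / (Nn+a)²`. -/
theorem transform_succ_sub (ha : 1 ≤ a) (hN : 1 ≤ N) (g : ℕ → ℝ) (n : ℕ) :
    transform ((a : ℝ) / N) g (n + 1) - transform ((a : ℝ) / N) g n =
      transform ((a : ℝ) / N) (fun k => ((N : ℝ) * k + a) ^ 2 * g k) (n + 1) /
        ((N : ℝ) * (n + 1 : ℕ) + a) ^ 2 := by
  have hN' : (0 : ℝ) < N := by exact_mod_cast hN
  have ha' : (0 : ℝ) < a := by exact_mod_cast ha
  have hα : 0 < (a : ℝ) / N := by positivity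
  have hD := denom_pos (N := N) ha (n + 1)
  -- The kernel vanishes for `k > n`, so both transforms run over the same range.
  have e : transform ((a : ℝ) / N) g n =
      ∑ k ∈ range (n + 1 + 1), connector ((a : ℝ) / N) n k * g k := by
    rw [sum_range_succ, connector_eq_zero _ (Nat.lt_succ_self n), zero_mul, add_zero, transform]
  rw [e]
  unfold transform
  rw [← sum_sub_distrib, sum_div]
  refine sum_congr rfl fun k _ => ?_
  have h := connector_succ_left hα n k
  rw [eq_div_iff (by positivity)]
  have e1 : (N : ℝ) * (n + 1 : ℕ) + a = N * (n + 1 + (a : ℝ) / N) := by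
    push_cast; field_simp
  have e2 : (N : ℝ) * k + a = N * (k + (a : ℝ) / N) := by field_simp
  beta_reduce
  rw [e1, e2]
  linear_combination (N : ℝ) ^ 2 * g k * h

/-- Summation against `1/(Nm+a)²` corresponds to division by `(Nk+a)²`. -/
theorem sum_transform_div_sq (ha : 1 ≤ a) (hN : 1 ≤ N) (g : ℕ → ℝ) (n : ℕ) :
    ∑ m ∈ range (n + 1), 1 / ((N : ℝ) * m + a) ^ 2 * transform ((a : ℝ) / N) g m =
      transform ((a : ℝ) / N) (fun k => g k / ((N : ℝ) * k + a) ^ 2) n := by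
  induction n with
  | zero => simp [transform]; ring
  | succ n ih =>
    rw [sum_range_succ, ih, ← eq_sub_iff_add_eq', transform_succ_sub ha hN]
    have : (fun k : ℕ => ((N : ℝ) * k + a) ^ 2 * (g k / ((N : ℝ) * k + a) ^ 2)) = g := by
      funext k
      have := denom_pos (N := N) ha k
      field_simp
    rw [this]
    ring

/-- Abel summation behind `sum_transform_div`. For `m = n + 1` the kernel in the last term
vanishes. -/
theorem sum_connector_mul_partialSum (ha : 1 ≤ a) (hN : 1 ≤ N) (g : ℕ → ℝ) (n m : ℕ) :
    ∑ k ∈ range m, connector ((a : ℝ) / N) n k *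
        (((N : ℝ) * k + a) * (2 * ∑ j ∈ range k, g j + g k)) =
      ((N : ℝ) * n + a) * ∑ k ∈ range m, connector ((a : ℝ) / N) n k * g k -
        (N * (n + m) + 2 * a) * connector ((a : ℝ) / N) n m * ∑ j ∈ range m, g j := by
  have hN' : (0 : ℝ) < N := by exact_mod_cast hN
  have ha' : (0 : ℝ) < a := by exact_mod_cast ha
  have hα : 0 < (a : ℝ) / N := by positivity
  induction m with
  | zero => simp
  | succ m ih =>
    rw [sum_range_succ, ih, sum_range_succ _ m, sum_range_succ _ m]
    have h := connector_succ_right hα n m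
    have hα' : (N : ℝ) * ((a : ℝ) / N) = a := by field_simp
    generalize (a : ℝ) / N = α at h hα' ⊢
    rw [← hα']
    push_cast
    linear_combination (N : ℝ) * (∑ j ∈ range m, g j + g m) * h

/-- Summation against `1/(Nm+a)` corresponds to a partial sum in which the last summand counts
one half, followed by division by `Nk+a`. -/
theorem sum_transform_div (ha : 1 ≤ a) (hN : 1 ≤ N) (g : ℕ → ℝ) (n : ℕ) :
    ∑ m ∈ range (n + 1), 1 / ((N : ℝ) * m + a) * transform ((a : ℝ) / N) g m =
      transform ((a : ℝ) / N)
        (fun k => (2 * ∑ j ∈ range k, g j + g k) / ((N : ℝ) * k + a)) n := by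
  induction n with
  | zero => simp [transform]; ring
  | succ n ih =>
    rw [sum_range_succ, ih, ← eq_sub_iff_add_eq', transform_succ_sub ha hN]
    have e : (fun k : ℕ => ((N : ℝ) * k + a) ^ 2 *
        ((2 * ∑ j ∈ range k, g j + g k) / ((N : ℝ) * k + a))) =
        fun k : ℕ => ((N : ℝ) * k + a) * (2 * ∑ j ∈ range k, g j + g k) := by
      funext k
      have := denom_pos (N := N) ha k
      field_simp
    have h := sum_connector_mul_partialSum ha hN g (n + 1) (n + 1 + 1)
    rw [connector_eq_zero _ (Nat.lt_succ_self (n + 1)), mul_zero, zero_mul, sub_zero] at h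
    have hD := denom_pos (N := N) ha (n + 1)
    rw [e, transform, transform, h]
    field_simp

theorem pochWeight_succ (N a m : ℕ) :
    (m + 1) * pochWeight N a (m + 1) = (2 * (a : ℝ) / N + m) * pochWeight N a m := by
  unfold pochWeight
  rw [ascPochhammer_succ_right, Nat.factorial_succ]
  simp only [Polynomial.eval_mul, Polynomial.eval_add, Polynomial.eval_X,
    Polynomial.eval_natCast]
  have h2 : (m.factorial : ℝ) ≠ 0 := by positivity
  have h3 : (m : ℝ) + 1 ≠ 0 := by positivity
  push_cast
  field_simp

/-- The telescoping well-poised sum behind `transform_pochWeight`. For `m = n + 1` the right-hand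
side vanishes. -/
theorem sum_connector_pochWeight (ha : 1 ≤ a) (hN : 1 ≤ N) (n m : ℕ) :
    2 * n * ∑ k ∈ range m, connector ((a : ℝ) / N) n k *
        ((-1) ^ k * pochWeight N a k * ((N : ℝ) * k + a)) =
      -((-1) ^ m * pochWeight N a m * m * (N * (n + m) + 2 * a) *
        connector ((a : ℝ) / N) n m) := by
  have hN' : (0 : ℝ) < N := by exact_mod_cast hN
  have ha' : (0 : ℝ) < a := by exact_mod_cast ha
  have hα : 0 < (a : ℝ) / N := by positivity
  induction m with
  | zero => simp
  | succ m ih =>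
    rw [sum_range_succ, mul_add, ih]
    have h := connector_succ_right hα n m
    have hp := pochWeight_succ N a m
    have hα' : (N : ℝ) * ((a : ℝ) / N) = a := by field_simp
    rw [mul_div_assoc] at hp
    generalize (a : ℝ) / N = α at h hα' hp ⊢
    rw [← hα']
    push_cast
    rw [pow_succ]
    linear_combination (-1) ^ m * N * (-(pochWeight N a m * (2 * α + m) * h) -
      (n + m + 1 + 2 * α) * connector α n (m + 1) * hp)

/-- The constant function `1` lies in the image of the transform. -/
theorem transform_pochWeight (ha : 1 ≤ a) (hN : 1 ≤ N) (n : ℕ) :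
    transform ((a : ℝ) / N) (fun k =>
      2 * N / ProbabilityTheory.beta ((a : ℝ) / N) ((a : ℝ) / N) *
        ((-1) ^ k * pochWeight N a k / ((N : ℝ) * k + a))) n = 1 := by
  have hN' : (0 : ℝ) < N := by exact_mod_cast hN
  have ha' : (0 : ℝ) < a := by exact_mod_cast ha
  have hα : 0 < (a : ℝ) / N := by positivity
  have hB := ProbabilityTheory.beta_pos hα hα
  rw [transform_const_mul]
  induction n with
  | zero =>
    simp [transform, connector, pochWeight]
    field_simp
  | succ n ih =>
    refine Eq.trans ?_ ih
    congr 1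
    rw [← sub_eq_zero, transform_succ_sub ha hN]
    have e : (fun k : ℕ => ((N : ℝ) * k + a) ^ 2 *
        ((-1) ^ k * pochWeight N a k / ((N : ℝ) * k + a))) =
        fun k : ℕ => (-1) ^ k * pochWeight N a k * ((N : ℝ) * k + a) := by
      funext k
      have := denom_pos (N := N) ha k
      field_simp
    have h := sum_connector_pochWeight ha hN (n + 1) (n + 1 + 1)
    rw [connector_eq_zero _ (Nat.lt_succ_self (n + 1)), mul_zero, neg_zero] at h
    have hn : (2 * ((n + 1 : ℕ) : ℝ)) ≠ 0 := by positivity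
    rw [e, transform, (mul_eq_zero.1 h).resolve_left hn, zero_div]

end

/-! ### Interpolated sums as nested sums -/

/-- The strictly decreasing truncated sum attached to an index list, for arbitrary entry weights
`φ` and an extra weight `v` on the last index. -/
noncomputable def listSum (φ : ℤ → ℕ → ℝ) (v : ℕ → ℝ) (s : List ℤ) (n : ℕ) : ℝ :=
  chainSum 1 (fun (i : Fin s.length) k =>
    φ (s.get i) k * if (i : ℕ) + 1 = s.length then v k else 1) n

theorem listSum_singleton (φ : ℤ → ℕ → ℝ) (v : ℕ → ℝ) (x : ℤ) (n : ℕ) :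
    listSum φ v [x] n = ∑ k ∈ range n, φ x k * v k := by
  unfold listSum
  rw [chainSum_succ]
  simp only [chainSum_zero]
  simp

theorem listSum_cons (φ : ℤ → ℕ → ℝ) (v : ℕ → ℝ) (x : ℤ) {l : List ℤ} (hl : l ≠ []) (n : ℕ) :
    listSum φ v (x :: l) n = ∑ k ∈ range n, φ x k * listSum φ v l k := by
  unfold listSum
  rw [chainSum_succ]
  refine sum_congr (by simp) fun k _ => congrArg₂ (· * ·) (by simp [hl]) ?_
  congr 1
  funext i k
  simp

theorem fillSymbols_ne_nil (x : ℤ) (r : List (Bool × ℤ)) : fillSymbols x r ≠ [] := by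
  induction r generalizing x with
  | nil => simp [fillSymbols]
  | cons p r ih =>
    obtain ⟨e, l⟩ := p
    cases e
    · simp [fillSymbols]
    · simpa [fillSymbols] using ih _

/-- The nested form of the interpolated sum: `nested r φ v s k` is its part with first index `k`.
In each nested partial sum the summand at the upper end has weight `r`. -/
noncomputable def nested (r : ℝ) (φ : ℤ → ℕ → ℝ) (v : ℕ → ℝ) :
    {d : ℕ} → (Fin (d + 1) → ℤ) → ℕ → ℝ
  | 0, s, k => φ (s 0) k * v k
  | _ + 1, s, k => φ (s 0) k * (∑ j ∈ range k, nested r φ v (Fin.tail s) j +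
      r * nested r φ v (Fin.tail s) k)

/-- Replacing a comma by a plus multiplies the nested form by the weight of the absorbed entry. -/
theorem nested_cons_signedAdd (r : ℝ) {φ : ℤ → ℕ → ℝ} (v : ℕ → ℝ)
    (hφ : ∀ x y, x ≠ 0 → y ≠ 0 → ∀ k, φ (signedAdd x y) k = φ x k * φ y k)
    {x : ℤ} (hx : x ≠ 0) {d : ℕ} (s : Fin (d + 1) → ℤ) (hs : s 0 ≠ 0) (k : ℕ) :
    nested r φ v (Fin.cons (signedAdd x (s 0)) (Fin.tail s) : Fin (d + 1) → ℤ) k =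
      φ x k * nested r φ v s k := by
  cases d with
  | zero => simp [nested, hφ x _ hx hs, mul_assoc]
  | succ d => simp [nested, hφ x _ hx hs, mul_assoc]

theorem signedAdd_ne_zero {x y : ℤ} (hx : x ≠ 0) : signedAdd x y ≠ 0 := by
  have := abs_pos.2 hx
  have := abs_nonneg y
  unfold signedAdd
  split_ifs <;> omega

/-- The truncated interpolated sum equals its nested form: a comma before the second entry gives
the terms whose first two indices differ, a plus those whose first two indices agree. -/
theorem sum_joinIndex_listSum (r : ℝ) {φ : ℤ → ℕ → ℝ} (v : ℕ → ℝ)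
    (hφ : ∀ x y, x ≠ 0 → y ≠ 0 → ∀ k, φ (signedAdd x y) k = φ x k * φ y k)
    {d : ℕ} (s : Fin (d + 1) → ℤ) (hs : ∀ i, s i ≠ 0) (n : ℕ) :
    ∑ ε : Fin d → Bool, r ^ (univ.filter fun i => ε i = true).card *
        listSum φ v (joinIndex s ε) n = ∑ k ∈ range n, nested r φ v s k := by
  induction d generalizing n with
  | zero => simp [joinIndex, fillSymbols, listSum_singleton, nested]
  | succ d ih =>
    rw [← (Fin.consEquiv fun _ => Bool).sum_comp, Fintype.sum_prod_type, Fintype.sum_bool]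
    have htrue : ∀ ε : Fin d → Bool,
        joinIndex s (Fin.cons true ε : Fin (d + 1) → Bool) =
          joinIndex (Fin.cons (signedAdd (s 0) (Fin.tail s 0)) (Fin.tail (Fin.tail s)) :
            Fin (d + 1) → ℤ) ε := by
      intro ε
      simp [joinIndex, List.ofFn_succ, fillSymbols, Fin.tail]
    have hfalse : ∀ ε : Fin d → Bool,
        joinIndex s (Fin.cons false ε : Fin (d + 1) → Bool) = s 0 :: joinIndex (Fin.tail s) ε := by
      intro ε
      simp [joinIndex, List.ofFn_succ, fillSymbols, Fin.tail]
    have hs' : ∀ i, Fin.tail s i ≠ 0 := fun i => hs i.succ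
    have ih1 := ih (Fin.cons (signedAdd (s 0) (Fin.tail s 0)) (Fin.tail (Fin.tail s)))
      (by
        intro i
        cases i using Fin.cases with
        | zero => simpa using signedAdd_ne_zero (hs 0)
        | succ i => rw [Fin.cons_succ]; exact hs' i.succ) n
    simp only [nested_cons_signedAdd r v hφ (hs 0) _ (hs' 0)] at ih1
    have ct : ∀ ε : Fin d → Bool, (univ.filter fun i =>
        (Fin.cons true ε : Fin (d + 1) → Bool) i = true).card =
        (univ.filter fun i => ε i = true).card + 1 := by
      intro ε
      rw [Fin.card_filter_univ_succ]
      simp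
    have cf : ∀ ε : Fin d → Bool, (univ.filter fun i =>
        (Fin.cons false ε : Fin (d + 1) → Bool) i = true).card =
        (univ.filter fun i => ε i = true).card := by
      intro ε
      rw [Fin.card_filter_univ_succ]
      simp
    have hc : ∀ e (ε : Fin d → Bool), (Fin.consEquiv fun _ : Fin (d + 1) => Bool) (e, ε) =
        (Fin.cons e ε : Fin (d + 1) → Bool) := fun _ _ => rfl
    simp only [hc, htrue, hfalse, ct, cf,
      listSum_cons φ v (s 0) (l := joinIndex _ _) (fillSymbols_ne_nil _ _)]
    have e1 : ∑ ε : Fin d → Bool, r ^ ((univ.filter fun i => ε i = true).card + 1) *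
        listSum φ v (joinIndex (Fin.cons (signedAdd (s 0) (Fin.tail s 0))
          (Fin.tail (Fin.tail s)) : Fin (d + 1) → ℤ) ε) n =
        ∑ k ∈ range n, φ (s 0) k * (r * nested r φ v (Fin.tail s) k) := by
      simp only [pow_succ', mul_assoc]
      rw [← mul_sum, ih1, mul_sum]
      exact sum_congr rfl fun k _ => by ring
    have e2 : ∑ ε : Fin d → Bool, r ^ (univ.filter fun i => ε i = true).card *
        ∑ k ∈ range n, φ (s 0) k * listSum φ v (joinIndex (Fin.tail s) ε) k =
        ∑ k ∈ range n, φ (s 0) k * ∑ j ∈ range k, nested r φ v (Fin.tail s) j := by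
      simp only [mul_sum]
      rw [sum_comm]
      refine sum_congr rfl fun k _ => ?_
      rw [← mul_sum, ← ih (Fin.tail s) hs' k, mul_sum]
      exact sum_congr rfl fun ε _ => by ring
    rw [e1, e2, ← sum_add_distrib]
    exact sum_congr rfl fun k _ => by simp only [nested]; ring

/-- The factor `1 / (k+1)` of an outer entry cancels the growth of the partial sum, so all inner
sums stay bounded by `1` and no logarithms arise. -/
theorem abs_nested_le {φ : ℤ → ℕ → ℝ} {v : ℕ → ℝ}
    (hφ : ∀ x k, |φ x k| ≤ 1 / ((k : ℝ) + 1) ^ x.natAbs) (hv : ∀ k, |v k| ≤ (k : ℝ) + 1)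
    {d : ℕ} (s : Fin (d + 1) → ℤ) (hs : ∀ i, s i ≠ 0) (k : ℕ) :
    |nested (1 / 2) φ v s k| ≤ 1 / ((k : ℝ) + 1) ^ (s 0).natAbs * (k + 1) := by
  induction d generalizing k with
  | zero =>
    rw [nested, abs_mul]
    gcongr
    · exact hφ _ _
    · exact hv k
  | succ d ih =>
    have h1 : ∀ j, |nested (1 / 2) φ v (Fin.tail s) j| ≤ 1 := by
      intro j
      refine (ih (Fin.tail s) (fun i => hs i.succ) j).trans ?_
      have h0 : (Fin.tail s 0).natAbs ≠ 0 := Int.natAbs_ne_zero.2 (hs (Fin.succ 0))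
      have h2 : (1 : ℝ) ≤ j + 1 := by linarith [(j.cast_nonneg : (0 : ℝ) ≤ j)]
      rw [one_div_mul_eq_div, div_le_one (by positivity)]
      exact le_self_pow₀ h2 h0
    rw [nested, abs_mul]
    gcongr
    · exact hφ _ _
    · refine (abs_add_le _ _).trans (add_le_add ?_ ?_)
      · refine (abs_sum_le_sum_abs _ _).trans ?_
        simpa using sum_le_sum (s := range k) fun j _ => h1 j
      · rw [abs_mul, abs_of_pos (by norm_num : (0 : ℝ) < 1 / 2)]
        linarith [h1 k]

theorem summable_nested {φ : ℤ → ℕ → ℝ} {v : ℕ → ℝ}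
    (hφ : ∀ x k, |φ x k| ≤ 1 / ((k : ℝ) + 1) ^ x.natAbs) (hv : ∀ k, |v k| ≤ (k : ℝ) + 1)
    {d : ℕ} (s : Fin (d + 1) → ℤ) (hs : ∀ i, s i ≠ 0) (hs0 : 3 ≤ (s 0).natAbs) :
    Summable (nested (1 / 2) φ v s) := by
  have h2 : Summable fun k : ℕ => 1 / ((k : ℝ) + 1) ^ 2 := by
    have := (summable_nat_add_iff 1).2 (Real.summable_one_div_nat_pow.2 (one_lt_two))
    simpa using this
  refine Summable.of_norm_bounded h2 fun k => (abs_nested_le hφ hv s hs k).trans ?_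
  have h1 : (1 : ℝ) ≤ k + 1 := by linarith [(k.cast_nonneg : (0 : ℝ) ≤ k)]
  calc 1 / ((k : ℝ) + 1) ^ (s 0).natAbs * (k + 1) ≤ 1 / ((k : ℝ) + 1) ^ 3 * (k + 1) := by
        gcongr
    _ = 1 / ((k : ℝ) + 1) ^ 2 := by field_simp

/-! ### The weights of the alternating series -/

/-- The factor `sign(x)^k / (Nk+a)^|x|` contributed by a signed index `x`. -/
noncomputable def signedFactor (N a : ℕ) (x : ℤ) (k : ℕ) : ℝ :=
  (x.sign : ℝ) ^ k / ((N : ℝ) * k + a) ^ x.natAbs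

theorem signedFactor_signedAdd (N a : ℕ) (x y : ℤ) (hx : x ≠ 0) (hy : y ≠ 0) (k : ℕ) :
    signedFactor N a (signedAdd x y) k = signedFactor N a x k * signedFactor N a y k := by
  have hpos : 0 < |x| + |y| := add_pos (abs_pos.2 hx) (abs_pos.2 hy)
  have h1 : (signedAdd x y).natAbs = x.natAbs + y.natAbs := by
    have : (|x| + |y|).natAbs = x.natAbs + y.natAbs := by
      zify
      exact abs_of_pos hpos
    unfold signedAdd
    split_ifs
    · exact this
    · rw [Int.natAbs_neg, this]
  have h2 : (signedAdd x y).sign = x.sign * y.sign := by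
    rw [← Int.sign_mul]
    unfold signedAdd
    split_ifs with h
    · rw [Int.sign_eq_one_of_pos hpos, Int.sign_eq_one_of_pos h]
    · have h' : x * y < 0 := lt_of_le_of_ne (not_lt.1 h) (mul_ne_zero hx hy)
      rw [Int.sign_eq_neg_one_of_neg h', Int.sign_eq_neg_one_of_neg (by omega)]
  simp only [signedFactor, h1, h2, Int.cast_mul, mul_pow, pow_add]
  rw [div_mul_div_comm]

theorem abs_signedFactor_le {N a : ℕ} (ha : 1 ≤ a) (hN : 1 ≤ N) (x : ℤ) (k : ℕ) :
    |signedFactor N a x k| ≤ 1 / ((k : ℝ) + 1) ^ x.natAbs := by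
  have hN' : (1 : ℝ) ≤ N := by exact_mod_cast hN
  have ha' : (1 : ℝ) ≤ a := by exact_mod_cast ha
  have hk : (0 : ℝ) ≤ k := k.cast_nonneg
  have hsign : |(x.sign : ℝ)| ≤ 1 := by
    rcases Int.sign_trichotomy x with h | h | h <;> simp [h]
  have hD : (k : ℝ) + 1 ≤ N * k + a := add_le_add (le_mul_of_one_le_left hk hN') ha'
  rw [signedFactor, abs_div, abs_pow, abs_of_pos (pow_pos (denom_pos (N := N) ha k) _)]
  gcongr
  exact pow_le_one₀ (abs_nonneg _) hsign

theorem pochWeight_nonneg (N a m : ℕ) : 0 ≤ pochWeight N a m := by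
  induction m with
  | zero => simp [pochWeight]
  | succ m ih =>
    have h := pochWeight_succ N a m
    have h1 : 0 ≤ (2 * (a : ℝ) / N + m) * pochWeight N a m := by positivity
    rw [← h] at h1
    exact nonneg_of_mul_nonneg_right h1 (by positivity)

theorem pochWeight_le {N a : ℕ} (hN : 1 ≤ N) (haN : a ≤ N) (m : ℕ) :
    pochWeight N a m ≤ m + 1 := by
  induction m with
  | zero => simp [pochWeight]
  | succ m ih =>
    have h := pochWeight_succ N a m
    have hN' : (0 : ℝ) < N := by exact_mod_cast hN
    have h2 : 2 * (a : ℝ) / N ≤ 2 := by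
      rw [div_le_iff₀ hN']
      have : (a : ℝ) ≤ N := by exact_mod_cast haN
      linarith
    have h3 : (0 : ℝ) < m + 1 := by positivity
    refine le_of_mul_le_mul_left ?_ h3
    rw [h]
    have := mul_le_mul (add_le_add_left h2 (m : ℝ)) ih (pochWeight_nonneg N a m) (by positivity)
    push_cast
    linarith

/-- Bounded truncated sums of absolute values make the series `t̃` summable, with its
truncations tending to its sum. -/
theorem tTilde_truncation {N a : ℕ} (s : List ℤ) {C : ℝ}
    (hC : ∀ n, listSum (fun x k => |signedFactor N a x k|) (fun k => |pochWeight N a k|) s n ≤ C) :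
    Summable (fun k : {k : Fin s.length → ℕ // StrictAnti k} => tTildeTerm N a s k) ∧
    Tendsto (listSum (signedFactor N a) (pochWeight N a) s) atTop (𝓝 (tTilde N a s)) := by
  refine summable_and_tendsto_chainSum 1 (fun (i : Fin s.length) k =>
    signedFactor N a (s.get i) k * if (i : ℕ) + 1 = s.length then pochWeight N a k else 1)
    (p := StrictAnti) (fun k => Iff.rfl) (C := C) fun n => (le_of_eq ?_).trans (hC n)
  unfold listSum
  congr 1
  funext i k
  rw [abs_mul]
  split_ifs <;> simp

/-! ### The star series -/

/-- The truncation of `t⋆` to chains bounded by `n`. -/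
noncomputable def starSum (N a : ℕ) (s : List ℕ) (n : ℕ) : ℝ :=
  chainSum 0 (fun (i : Fin s.length) k => 1 / ((N : ℝ) * k + a) ^ s.get i) n

theorem starSum_nil (N a n : ℕ) : starSum N a [] n = 1 := chainSum_zero ..

theorem starSum_cons (N a x : ℕ) (l : List ℕ) (n : ℕ) :
    starSum N a (x :: l) n =
      ∑ k ∈ range (n + 1), 1 / ((N : ℝ) * k + a) ^ x * starSum N a l k :=
  chainSum_succ ..

/-- The terms of `t⋆` are nonnegative, so bounded truncations suffice for convergence. -/
theorem tStar_truncation {N a : ℕ} (s : List ℕ) {C : ℝ} (hC : ∀ n, starSum N a s n ≤ C) :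
    Summable (fun k : {k : Fin s.length → ℕ // Antitone k} => tStarTerm N a s k) ∧
    Tendsto (starSum N a s) atTop (𝓝 (tStar N a s)) := by
  refine summable_and_tendsto_chainSum 0 (fun (i : Fin s.length) k =>
    1 / ((N : ℝ) * k + a) ^ s.get i) (p := Antitone)
    (fun k => antitone_iff_forall_lt.trans (by simp)) (C := C)
    fun n => (le_of_eq ?_).trans (hC n)
  unfold starSum
  congr 1
  funext i k
  exact abs_of_nonneg (by positivity)

theorem starSum_replicate_two_append {N a : ℕ} (ha : 1 ≤ a) (hN : 1 ≤ N) (m : ℕ) (l : List ℕ)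
    {g : ℕ → ℝ} (hg : ∀ n, starSum N a l n = transform ((a : ℝ) / N) g n) (n : ℕ) :
    starSum N a (List.replicate m 2 ++ l) n =
      transform ((a : ℝ) / N) (fun k => g k / ((N : ℝ) * k + a) ^ (2 * m)) n := by
  induction m generalizing n with
  | zero => simp [hg]
  | succ m ih =>
    rw [List.replicate_succ, List.cons_append, starSum_cons]
    simp only [ih]
    rw [sum_transform_div_sq ha hN]
    congr 1
    funext k
    rw [div_div, ← pow_add]
    rfl

theorem starSum_one_cons {N a : ℕ} (ha : 1 ≤ a) (hN : 1 ≤ N) (l : List ℕ)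
    {g : ℕ → ℝ} (hg : ∀ n, starSum N a l n = transform ((a : ℝ) / N) g n) (n : ℕ) :
    starSum N a (1 :: l) n = transform ((a : ℝ) / N)
      (fun k => (2 * ∑ j ∈ range k, g j + g k) / ((N : ℝ) * k + a)) n := by
  rw [starSum_cons]
  simp only [hg, pow_one]
  exact sum_transform_div ha hN g n

theorem oddIndices_ne_zero {d : ℕ} (b : Fin (d + 1) → ℕ) (i : Fin (d + 1)) :
    oddIndices b i ≠ 0 := by
  unfold oddIndices
  split_ifs <;> omega

theorem natAbs_oddIndices {d : ℕ} (b : Fin (d + 1) → ℕ) (i : Fin (d + 1)) :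
    (oddIndices b i).natAbs = 2 * b i + 1 := by
  unfold oddIndices
  split_ifs <;> omega

theorem tail_oddIndices {d : ℕ} (b : Fin (d + 2) → ℕ) :
    Fin.tail (oddIndices b) = oddIndices (Fin.tail b) := by
  funext i
  simp [Fin.tail, oddIndices, ← Fin.succ_last]

/-- The truncated form of the identity, valid for every `n`. The string `{2}^{b_0}, 1, …` is read
from its right end, and each entry is carried through the transform by the matching summation
rule. -/
theorem starSum_twosOnes {N a : ℕ} (ha : 1 ≤ a) (hN : 1 ≤ N) {d : ℕ} (b : Fin (d + 1) → ℕ)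
    (n : ℕ) :
    starSum N a (twosOnes b) n = transform ((a : ℝ) / N) (fun k =>
      2 ^ (d + 1) * (N : ℝ) / ProbabilityTheory.beta ((a : ℝ) / N) ((a : ℝ) / N) *
        nested (1 / 2) (signedFactor N a) (pochWeight N a) (oddIndices b) k) n := by
  induction d generalizing n with
  | zero =>
    have h1 : twosOnes b = List.replicate (b 0) 2 ++ [] := by simp [twosOnes]
    rw [h1, starSum_replicate_two_append ha hN (b 0) []
      fun n => (starSum_nil N a n).trans (transform_pochWeight ha hN n).symm]
    congr 1
    funext k
    have hD := denom_pos (N := N) ha k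
    have hsign : (oddIndices b 0).sign = -1 := Int.sign_eq_neg_one_of_neg (by
      simp [oddIndices]; omega)
    rw [nested, signedFactor, natAbs_oddIndices, hsign, pow_succ _ (2 * b 0)]
    push_cast
    field_simp
  | succ d ih =>
    have h1 : twosOnes b = List.replicate (b 0) 2 ++ (1 :: twosOnes (Fin.tail b)) := by
      simp [twosOnes, List.ofFn_succ, Fin.tail]
    rw [h1, starSum_replicate_two_append ha hN (b 0) _
      (starSum_one_cons ha hN _ (ih (Fin.tail b)))]
    congr 1
    funext k
    have hD := denom_pos (N := N) ha k
    have hsign : (oddIndices b 0).sign = 1 := Int.sign_eq_one_of_pos (by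
      have : (0 : Fin (d + 2)) ≠ Fin.last (d + 1) := (Fin.last_pos).ne
      simp only [oddIndices, this, if_false]; omega)
    rw [nested, tail_oddIndices, signedFactor, natAbs_oddIndices, hsign, ← mul_sum,
      pow_succ _ (2 * b 0), pow_succ _ (d + 1)]
    push_cast
    rw [one_pow]
    field_simp

theorem mainTheorem8 (N a : ℕ) (ha : 1 ≤ a) (haN : a ≤ N) (d : ℕ) (hd : 1 ≤ d)
    (b : Fin (d + 1) → ℕ) (hb : 1 ≤ b 0) :
    (Summable fun k : {k : Fin (twosOnes b).length → ℕ // Antitone k} =>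
      tStarTerm N a (twosOnes b) k) ∧
    (∀ ε : Fin d → Bool,
      Summable fun k : {k : Fin (joinIndex (oddIndices b) ε).length → ℕ // StrictAnti k} =>
        tTildeTerm N a (joinIndex (oddIndices b) ε) k) ∧
    tStar N a (twosOnes b) =
      2 ^ (d + 1) * (N : ℝ) / ProbabilityTheory.beta ((a : ℝ) / N) ((a : ℝ) / N) *
        tTildeInterp N a (1 / 2) (oddIndices b) := by
  have hN : 1 ≤ N := ha.trans haN
  have hα : 0 < (a : ℝ) / N := by
    have hN' : (0 : ℝ) < N := by exact_mod_cast hN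
    have ha' : (0 : ℝ) < a := by exact_mod_cast ha
    positivity
  have hφ := abs_signedFactor_le (N := N) ha hN
  have hv : ∀ k, |pochWeight N a k| ≤ (k : ℝ) + 1 := fun k => by
    rw [abs_of_nonneg (pochWeight_nonneg N a k)]
    exact pochWeight_le hN haN k
  have hs := oddIndices_ne_zero b
  have hs0 : 3 ≤ (oddIndices b 0).natAbs := by rw [natAbs_oddIndices]; omega
  have hsum := summable_nested hφ hv _ hs hs0
  have hsumabs := summable_nested (φ := fun x k => |signedFactor N a x k|)
    (v := fun k => |pochWeight N a k|) (by simpa using hφ) (by simpa using hv) _ hs hs0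
  -- The interpolated sum of absolute values bounds each of its nonnegative parts.
  obtain ⟨A, hA⟩ := hsumabs.hasSum.tendsto_sum_nat.bddAbove_range
  have hbound : ∀ (ε : Fin d → Bool) n,
      listSum (fun x k => |signedFactor N a x k|) (fun k => |pochWeight N a k|)
        (joinIndex (oddIndices b) ε) n ≤
          A / (1 / 2) ^ (univ.filter fun i => ε i = true).card := by
    intro ε n
    rw [le_div_iff₀' (by positivity)]
    refine le_trans ?_ (hA ⟨n, rfl⟩)
    beta_reduce
    rw [← sum_joinIndex_listSum (1 / 2) _ (fun x y hx hy k => by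
      rw [signedFactor_signedAdd N a x y hx hy, abs_mul]) _ hs n]
    refine single_le_sum (f := fun ε : Fin d → Bool =>
      (1 / 2 : ℝ) ^ (univ.filter fun i => ε i = true).card *
        listSum (fun x k => |signedFactor N a x k|) (fun k => |pochWeight N a k|)
          (joinIndex (oddIndices b) ε) n) (fun ε _ => ?_) (mem_univ ε)
    refine mul_nonneg (by positivity) (sum_nonneg fun k _ => prod_nonneg fun i _ => ?_)
    refine mul_nonneg (abs_nonneg _) ?_
    split_ifs
    exacts [abs_nonneg _, zero_le_one]
  have htilde := fun ε => tTilde_truncation (N := N) (a := a) _ (hbound ε)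
  have hlim : Tendsto (starSum N a (twosOnes b)) atTop (𝓝 _) :=
    (transform_tendsto hα (hsum.mul_left _)).congr fun n => (starSum_twosOnes ha hN b n).symm
  obtain ⟨C, hC⟩ := hlim.bddAbove_range
  obtain ⟨hstar, hstar'⟩ := tStar_truncation (N := N) (a := a) (twosOnes b) (C := C)
    fun n => hC ⟨n, rfl⟩
  refine ⟨hstar, fun ε => (htilde ε).1, ?_⟩
  rw [tendsto_nhds_unique hstar' hlim, tsum_mul_left]
  congr 1
  refine tendsto_nhds_unique hsum.hasSum.tendsto_sum_nat ?_
  refine (tendsto_finsetSum univ fun ε _ => (htilde ε).2.const_mul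
    ((1 / 2 : ℝ) ^ (univ.filter fun i => ε i = true).card)).congr fun n => ?_
  exact sum_joinIndex_listSum (1 / 2) _ (signedFactor_signedAdd N a) _ hs n
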